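/- Let $p$ be a prime, let $d\ge 0$ be an integer and let $G$ be a finite group. For $n\ge 0$ let $G_n=G\wr\mathfrak S_n=G^n\rtimes\mathfrak S_n$ be the wreath product, where $\mathfrak S_n$ permutes the factors of $G^n$, and let $\mathbb Z_p$ be the additive group of $p$-adic integers. For a finite group $H$ let $\mathrm{Hom}(\mathbb Z_p^d,H)/H$ be the set of orbits of the conjugation action of $H$ on the set of group homomorphisms $\mathbb Z_p^d\to H$. Then the sets $\mathrm{Hom}(\mathbb Z_p^d,G)/G$ and $\mathrm{Hom}(\mathbb Z_p^d,G_n)/G_n$ are finite, and in the ring $\mathbb Z[[q]]$ of formal power series $$\sum_{n\ge0}q^n\,\bigl|\mathrm{Hom}(\mathbb Z_p^d,G_n)/G_n\bigr|=\Bigl[\prod_{\ell_1,\dots,\ell_d\ge0}\bigl(1-q^{p^{\ell_1+\cdots+\ell_d}}\bigr)^{p^{\ell_2+2\ell_3+\cdots+(d-1)\ell_d}}\Bigr]^{-|\mathrm{Hom}(\mathbb Z_p^d,G)/G|},$$ where the infinite product converges unconditionally, coefficient by coefficient, to an invertible power series (for $d=0$ it is the single factor $1-q$). Moreover, for every $n\ge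 0$, $|\mathrm{Hom}(\mathbb Z_p^d,G_n)/G_n|$ is the number of simultaneous conjugacy classes of $d$-tuples of pairwise commuting elements of $G_n$ whose orders are powers of $p$. -/

import Mathlib

open scoped PowerSeries PowerSeries.WithPiTopology

/-- The wreath product of a group `G` with the symmetric group on `n` letters: the semidirect
product `G ^ n ⋊ S_n`, where `(s • g) i = g (s⁻¹ i)`. -/
abbrev WreathSymm (G : Type*) [Group G] (n : ℕ) : Type _ :=
  (Fin n → G) ⋊[(mulAutArrow : Equiv.Perm (Fin n) →* MulAut (Fin n → G))] Equiv.Perm (Fin n)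

/-- The relation "conjugate by an element of `H`" on homomorphisms `K → H`. -/
def homConjSetoid (K H : Type*) [Group K] [Group H] : Setoid (K →* H) where
  r φ ψ := ∃ h : H, ∀ k : K, ψ k = h * φ k * h⁻¹
  iseqv :=
    { refl := fun φ => ⟨1, fun k => by simp⟩
      symm := by
        rintro φ ψ ⟨h, hh⟩
        exact ⟨h⁻¹, fun k => by rw [hh k]; group⟩
      trans := by
        rintro φ ψ χ ⟨h, hh⟩ ⟨h', hh'⟩
        exact ⟨h' * h, fun k => by rw [hh' k, hh k]; group⟩ }

/-- The orbit set `Hom(K, H) / H` of the conjugation action of `H` on `Hom(K, H)`. -/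
abbrev HomModConj (K H : Type*) [Group K] [Group H] : Type _ :=
  Quotient (homConjSetoid K H)

/-- The additive group `ℤ_p ^ d`, written multiplicatively. -/
abbrev PadicPow (p : ℕ) [Fact p.Prime] (d : ℕ) : Type :=
  Multiplicative (Fin d → ℤ_[p])

/-- Tuples of `d` pairwise commuting elements of `H`, each of order a power of `p`. -/
abbrev CommTuple (p d : ℕ) (H : Type*) [Group H] : Type _ :=
  {x : Fin d → H // (∀ i j, Commute (x i) (x j)) ∧ ∀ i, ∃ k : ℕ, orderOf (x i) = p ^ k}

/-- The relation of simultaneous conjugacy on such tuples. -/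
def commTupleSetoid (p d : ℕ) (H : Type*) [Group H] : Setoid (CommTuple p d H) where
  r x y := ∃ h : H, ∀ i, y.1 i = h * x.1 i * h⁻¹
  iseqv :=
    { refl := fun x => ⟨1, fun i => by simp⟩
      symm := by
        rintro x y ⟨h, hh⟩
        exact ⟨h⁻¹, fun i => by rw [hh i]; group⟩
      trans := by
        rintro x y z ⟨h, hh⟩ ⟨h', hh'⟩
        exact ⟨h' * h, fun i => by rw [hh' i, hh i]; group⟩ }

/-- Simultaneous conjugacy classes of `d`-tuples of pairwise commuting elements of `H` of
`p`-power order. -/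
abbrev CommTupleModConj (p d : ℕ) (H : Type*) [Group H] : Type _ :=
  Quotient (commTupleSetoid p d H)

/-!
# Homomorphisms from `ℤ_p ^ d` to wreath products

A homomorphism `Γ → G ≀ S_n` is an action of `Γ` by bundle automorphisms on the trivial principal
`G`-bundle over `n` points, and conjugate homomorphisms are isomorphic actions
(`TwistedAction.ofHom_iso_ofHom_iff`, `TwistedAction.exists_iso_ofHom`). Such an object is a
disjoint union of transitive ones. For commutative `Γ` the transitive objects are classified by the
stabilizer `H` of a point, a subgroup of finite index, and the conjugacy class of the homomorphism
`H → G` which describes how `H` acts on the fibre over that point; the number of points is the index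
of `H`. Hence conjugacy classes of homomorphisms `Γ → G ≀ S_n` are counted by finite multisets of
such pairs, weighted by the index
(`TwistedAction.card_homModConj_wreathSymm`), and their generating function is the inverse of the
product of the `1 - q ^ index` over all pairs (`exists_unit_hasProd_one_sub`).

For `Γ = ℤ_p ^ d` every subgroup of finite index is a `ℤ_p`-submodule, free of rank `d`, so that
each of them carries the same number `|Hom(ℤ_p ^ d, G) / G|` of classes
(`isTransversal_padicTransversal`). This number becomes the exponent. The submodules themselves are
counted by induction on `d`: one of `ℤ_p × M` consists of its projection `p ^ l ℤ_p` to `ℤ_p`, its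
intersection `N` with `M`, and a coset of `N` (`glueEquiv`), which yields the exponents in the
product (`exists_label_finiteIndexSubmodule`).

Finally, a finite quotient of `ℤ_p ^ d` is a `p`-group, so a homomorphism to a finite group is the
same as a commuting `d`-tuple of elements of `p`-power order (`padicHomEquiv`).
-/

/-! ### Generating functions of weighted multisets -/

/-- The geometric series `∑ k, X ^ (w * k)`, for `w > 0`. -/
noncomputable def geomSeries (w : ℕ) : ℤ⟦X⟧ :=
  PowerSeries.mk fun n => if w ∣ n then 1 else 0

theorem geomSeries_mul_one_sub {w : ℕ} (hw : 0 < w) :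
    geomSeries w * (1 - (PowerSeries.X : ℤ⟦X⟧) ^ w) = 1 := by
  ext n
  rw [mul_sub, mul_one, map_sub, PowerSeries.coeff_mul_X_pow', PowerSeries.coeff_one]
  simp only [geomSeries, PowerSeries.coeff_mk]
  rcases lt_or_ge n w with h | h
  · rw [if_neg (not_le.2 h), sub_zero]
    refine if_congr ⟨fun hd => Nat.eq_zero_of_dvd_of_lt hd h, ?_⟩ rfl rfl
    rintro rfl
    exact dvd_zero _
  · rw [if_pos h, if_congr (Nat.dvd_sub_iff_left h dvd_rfl) rfl rfl, sub_self, if_neg (by omega)]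

/-- The number of finite multisets on `T`, of total weight `n`, where `t` has weight `w t`; a
multiset is recorded by its multiplicity function. The value is `0` if there are infinitely many. -/
noncomputable def weightedCount {T : Type*} (w : T → ℕ) (n : ℕ) : ℕ :=
  Nat.card {f : T →₀ ℕ // (f.sum fun t k => k * w t) = n}

/-- As soon as `s` contains all elements of weight at most `n`, the `n`-th coefficient of the
product of geometric series over `s` counts all multisets of weight `n`. -/
theorem coeff_prod_geomSeries {T : Type*} (w : T → ℕ) (hw : ∀ t, 0 < w t) (n : ℕ)
    (s : Finset T) (hs : ∀ t, w t ≤ n → t ∈ s) :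
    PowerSeries.coeff n (∏ t ∈ s, geomSeries (w t)) = (weightedCount w n : ℤ) := by
  classical
  rw [PowerSeries.coeff_prod]
  simp only [geomSeries, PowerSeries.coeff_mk, Finset.prod_ite_zero, Finset.prod_const_one]
  rw [Finset.sum_boole, weightedCount, Nat.cast_inj, ← Nat.card_eq_finsetCard]
  have hsum : ∀ f : T →₀ ℕ, f.support ⊆ s →
      (f.sum fun t k => k * w t) = ∑ t ∈ s, f t * w t := fun f hf =>
    Finsupp.sum_of_support_subset f hf _ fun _ _ => zero_mul _
  have hsupp : ∀ f : T →₀ ℕ, (f.sum fun t k => k * w t) = n → f.support ⊆ s := by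
    intro f hf t ht
    refine hs t ?_
    have h1 : f t * w t ≤ n := by
      rw [← hf]
      exact Finset.single_le_sum (f := fun t => f t * w t) (fun _ _ => Nat.zero_le _) ht
    exact (Nat.le_mul_of_pos_left _ (Nat.pos_of_ne_zero (Finsupp.mem_support_iff.1 ht))).trans h1
  refine (Nat.card_congr ?_).symm
  refine
    { toFun := fun f => ⟨Finsupp.onFinset s (fun t => f.1 t * w t) fun t ht =>
        hsupp f.1 f.2 (Finsupp.mem_support_iff.2 (left_ne_zero_of_mul ht)), ?_⟩
      invFun := fun l => ⟨Finsupp.onFinset s (fun t => l.1 t / w t) fun t ht => ?_, ?_⟩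
      left_inv := ?_
      right_inv := ?_ }
  · rw [Finset.mem_filter, Finset.mem_finsuppAntidiag]
    refine ⟨⟨?_, Finsupp.support_onFinset_subset⟩, fun t _ => dvd_mul_left _ _⟩
    exact (hsum f.1 (hsupp f.1 f.2)).symm.trans f.2
  · have h := (Finset.mem_finsuppAntidiag.1 (Finset.mem_filter.1 l.2).1).2
    refine h (Finsupp.mem_support_iff.2 fun h0 => ht ?_)
    rw [h0, Nat.zero_div]
  · obtain ⟨h1, h2⟩ := Finset.mem_filter.1 l.2
    rw [hsum _ Finsupp.support_onFinset_subset]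
    exact (Finset.sum_congr rfl fun t ht => Nat.div_mul_cancel (h2 t ht)).trans
      (Finset.mem_finsuppAntidiag.1 h1).1
  · intro f
    ext t
    exact Nat.mul_div_cancel _ (hw t)
  · intro l
    obtain ⟨h1, h2⟩ := Finset.mem_filter.1 l.2
    ext t
    refine Nat.div_mul_cancel ?_
    by_cases ht : t ∈ s
    · exact h2 t ht
    · rw [Finsupp.notMem_support_iff.1 fun h => ht ((Finset.mem_finsuppAntidiag.1 h1).2 h)]
      exact dvd_zero _

/-- Euler's product for multisets: if every weight is attained finitely often, the product of the
`1 - X ^ w t` converges unconditionally to a unit, whose inverse is the generating function of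
finite multisets by total weight. -/
theorem exists_unit_hasProd_one_sub {T : Type*} (w : T → ℕ) (hw : ∀ t, 0 < w t)
    (hfin : ∀ n, {t | w t ≤ n}.Finite) :
    ∃ U : ℤ⟦X⟧ˣ, HasProd (fun t => 1 - (PowerSeries.X : ℤ⟦X⟧) ^ w t) (U : ℤ⟦X⟧) ∧
      PowerSeries.mk (fun n => (weightedCount w n : ℤ)) = ((U⁻¹ : ℤ⟦X⟧ˣ) : ℤ⟦X⟧) := by
  classical
  set F : ℤ⟦X⟧ := PowerSeries.mk fun n => (weightedCount w n : ℤ) with hF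
  have hcoeff : ∀ n (s : Finset T), (∀ t, w t ≤ n → t ∈ s) →
      PowerSeries.X ^ (n + 1) ∣ F - ∏ t ∈ s, geomSeries (w t) := by
    intro n s hs
    refine PowerSeries.X_pow_dvd_iff.2 fun m hm => ?_
    rw [map_sub, hF, PowerSeries.coeff_mk,
      coeff_prod_geomSeries w hw m s fun t ht => hs t (by omega), sub_self]
  have hunit : IsUnit F := by
    rw [PowerSeries.isUnit_iff_constantCoeff, ← PowerSeries.coeff_zero_eq_constantCoeff_apply]
    have h := coeff_prod_geomSeries w hw 0 (hfin 0).toFinset fun t ht => by simpa using ht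
    have h0 : (hfin 0).toFinset = ∅ := by
      ext t
      simpa using (hw t).ne'
    rw [hF, PowerSeries.coeff_mk, ← h, h0]
    simp
  obtain ⟨V, hV⟩ := hunit
  refine ⟨V⁻¹, ?_, by rw [inv_inv, hV]⟩
  rw [HasProd, PowerSeries.WithPiTopology.tendsto_iff_coeff_tendsto]
  intro n
  refine tendsto_atTop_of_eventually_const (i₀ := (hfin n).toFinset) fun s hs => ?_
  have hs' : ∀ t, w t ≤ n → t ∈ s := fun t ht => hs (by simpa using ht)
  set a := ∏ t ∈ s, (1 - (PowerSeries.X : ℤ⟦X⟧) ^ w t) with ha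
  have hGa : (∏ t ∈ s, geomSeries (w t)) * a = 1 := by
    rw [ha, ← Finset.prod_mul_distrib]
    exact Finset.prod_eq_one fun t _ => geomSeries_mul_one_sub (hw t)
  -- with `G` the finite product of geometric series, `a - F⁻¹ = F⁻¹ (F - G) a`
  have hdvd : PowerSeries.X ^ (n + 1) ∣ a - ((V⁻¹ : ℤ⟦X⟧ˣ) : ℤ⟦X⟧) := by
    have h1 : a - ((V⁻¹ : ℤ⟦X⟧ˣ) : ℤ⟦X⟧) =
        ((V⁻¹ : ℤ⟦X⟧ˣ) : ℤ⟦X⟧) * a * (F - ∏ t ∈ s, geomSeries (w t)) := by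
      have h2 : ((V⁻¹ : ℤ⟦X⟧ˣ) : ℤ⟦X⟧) * F = 1 := by rw [← hV, Units.inv_mul]
      linear_combination (-a) * h2 + ((V⁻¹ : ℤ⟦X⟧ˣ) : ℤ⟦X⟧) * hGa
    rw [h1]
    exact (hcoeff n s hs').mul_left _
  have h3 := PowerSeries.X_pow_dvd_iff.1 hdvd n (Nat.lt_succ_self n)
  rwa [map_sub, sub_eq_zero] at h3

/-- The generating function of multisets on `S × C`, with `C` finite and the weight of `(s, c)` a
function `v` of a label `L s` taking each value `i` exactly `m i` times, is the power of exponent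
`-|C|` of the product of the `(1 - X ^ v i) ^ m i`. -/
theorem exists_unit_hasProd_weightedCount_prod {S ι C : Type*} [Finite C] (L : S → ι) (v : ι → ℕ)
    (m : ι → ℕ) (hv : ∀ i, 0 < v i) (hvfin : ∀ n, {i | v i ≤ n}.Finite)
    (hm : ∀ i, 0 < m i) (hL : ∀ i, Nat.card {s // L s = i} = m i) :
    ∃ P : ℤ⟦X⟧ˣ, HasProd (fun i => (1 - (PowerSeries.X : ℤ⟦X⟧) ^ v i) ^ m i) (P : ℤ⟦X⟧) ∧
      PowerSeries.mk (fun n => (weightedCount (fun t : S × C => v (L t.1)) n : ℤ)) =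
        ((P ^ (-(Nat.card C : ℤ)) : ℤ⟦X⟧ˣ) : ℤ⟦X⟧) := by
  have hfib : ∀ i, Finite {s // L s = i} := fun i =>
    Nat.finite_of_card_ne_zero (by rw [hL i]; exact (hm i).ne')
  have hSfin : ∀ n, {s | v (L s) ≤ n}.Finite := by
    intro n
    refine Set.Finite.preimage' (f := L) (hvfin n) fun i _ => ?_
    exact hfib i
  obtain ⟨P, hP, -⟩ := exists_unit_hasProd_one_sub (fun s => v (L s)) (fun s => hv _) hSfin
  obtain ⟨U, hU, hF⟩ := exists_unit_hasProd_one_sub (fun t : S × C => v (L t.1)) (fun t => hv _)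
    fun n => ((hSfin n).prod (Set.toFinite (Set.univ : Set C))).subset fun t ht =>
      ⟨ht, Set.mem_univ _⟩
  have := Fintype.ofFinite C
  have hUP : U = P ^ Nat.card C := by
    have h1 : HasProd (fun s => (1 - (PowerSeries.X : ℤ⟦X⟧) ^ v (L s)) ^ Nat.card C)
        (U : ℤ⟦X⟧) := by
      refine HasProd.prod_fiberwise hU fun s => ?_
      have h2 := hasProd_fintype fun _ : C => 1 - (PowerSeries.X : ℤ⟦X⟧) ^ v (L s)
      rwa [Finset.prod_const, Finset.card_univ, ← Nat.card_eq_fintype_card] at h2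
    have h3 : HasProd (fun s => (1 - (PowerSeries.X : ℤ⟦X⟧) ^ v (L s)) ^ Nat.card C)
        ((P : ℤ⟦X⟧) ^ Nat.card C) := by
      have h4 := hasProd_prod (s := Finset.univ (α := C)) fun _ _ => hP
      simpa only [Finset.prod_const, Finset.card_univ, ← Nat.card_eq_fintype_card] using h4
    exact Units.ext (by rw [h1.unique h3, Units.val_pow_eq_pow_val])
  refine ⟨P, ?_, by rw [hF, hUP, zpow_neg, zpow_natCast]⟩
  refine HasProd.sigma ((Equiv.hasProd_iff (Equiv.sigmaFiberEquiv L)).2 hP) fun i => ?_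
  have := hfib i
  have := Fintype.ofFinite {s // L s = i}
  have h1 := hasProd_fintype fun s : {s // L s = i} => 1 - (PowerSeries.X : ℤ⟦X⟧) ^ v (L s)
  rw [Finset.prod_congr rfl fun s _ => by rw [s.2], Finset.prod_const, Finset.card_univ,
    ← Nat.card_eq_fintype_card, hL] at h1
  exact h1

/-! ### Twisted actions and homomorphisms to wreath products -/

theorem WreathSymm.mul_left_apply {G : Type*} [Group G] {n : ℕ} (a b : WreathSymm G n)
    (i : Fin n) : (a * b).left i = a.left i * b.left (a.right⁻¹ i) := rfl

/-- An action of `Γ` on `X` together with a `G`-valued cocycle: the trivial principal `G`-bundle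
over `X` with an action of `Γ` by bundle automorphisms, `γ • (x, a) = (γ x, coc γ x * a)`. -/
structure TwistedAction (Γ G X : Type*) [Group Γ] [Group G] where
  /-- The action on the base. -/
  perm : Γ →* Equiv.Perm X
  /-- The cocycle. -/
  coc : Γ → X → G
  coc_mul : ∀ γ δ x, coc (γ * δ) x = coc γ (perm δ x) * coc δ x

namespace TwistedAction

section General

variable {Γ G X Y Z J : Type*} [Group Γ] [Group G]

/-- Isomorphism of equivariant bundles: the isomorphism is `(x, a) ↦ (e x, h x * a)`. -/
def Iso (F : TwistedAction Γ G X) (F' : TwistedAction Γ G Y) : Prop :=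
  ∃ (e : X ≃ Y) (h : X → G), (∀ γ x, e (F.perm γ x) = F'.perm γ (e x)) ∧
    ∀ γ x, F'.coc γ (e x) = h (F.perm γ x) * F.coc γ x * (h x)⁻¹

theorem Iso.symm {F : TwistedAction Γ G X} {F' : TwistedAction Γ G Y} (i : F.Iso F') :
    F'.Iso F := by
  obtain ⟨e, h, h1, h2⟩ := i
  have h3 : ∀ γ y, e.symm (F'.perm γ y) = F.perm γ (e.symm y) := fun γ y => by
    rw [Equiv.symm_apply_eq, h1, e.apply_symm_apply]
  refine ⟨e.symm, fun y => (h (e.symm y))⁻¹, h3, fun γ y => ?_⟩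
  have h4 := h2 γ (e.symm y)
  rw [e.apply_symm_apply] at h4
  beta_reduce
  rw [h3, h4]
  group

theorem Iso.trans {F : TwistedAction Γ G X} {F' : TwistedAction Γ G Y}
    {F'' : TwistedAction Γ G Z} (i : F.Iso F') (i' : F'.Iso F'') : F.Iso F'' := by
  obtain ⟨e, h, h1, h2⟩ := i
  obtain ⟨e', h', h1', h2'⟩ := i'
  refine ⟨e.trans e', fun x => h' (e x) * h x, fun γ x => ?_, fun γ x => ?_⟩
  · rw [Equiv.trans_apply, h1, h1', Equiv.trans_apply]
  · beta_reduce
    rw [Equiv.trans_apply, h2', h2, h1]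
    group

/-- The twisted action on `n` points defined by a homomorphism to the wreath product. -/
def ofHom {n : ℕ} (φ : Γ →* WreathSymm G n) : TwistedAction Γ G (Fin n) where
  perm := SemidirectProduct.rightHom.comp φ
  coc γ i := (φ γ).left ((φ γ).right i)
  coc_mul γ δ i := by
    simp [WreathSymm.mul_left_apply]

@[simp] theorem ofHom_perm {n : ℕ} (φ : Γ →* WreathSymm G n) (γ : Γ) :
    (ofHom φ).perm γ = (φ γ).right := rfl

@[simp] theorem ofHom_coc {n : ℕ} (φ : Γ →* WreathSymm G n) (γ : Γ) (i : Fin n) :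
    (ofHom φ).coc γ i = (φ γ).left ((φ γ).right i) := rfl

theorem ofHom_iso_ofHom_iff {n : ℕ} (φ ψ : Γ →* WreathSymm G n) :
    (ofHom φ).Iso (ofHom ψ) ↔ (homConjSetoid Γ (WreathSymm G n)).r φ ψ := by
  constructor
  · rintro ⟨e, h, h1, h2⟩
    refine ⟨⟨fun j => h (e.symm j), e⟩, fun γ => ?_⟩
    rw [eq_mul_inv_iff_mul_eq]
    have hr : (ψ γ).right * e = e * (φ γ).right := Equiv.ext fun i => (h1 γ i).symm
    refine SemidirectProduct.ext (funext fun j => ?_) hr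
    obtain ⟨i, rfl⟩ : ∃ i, j = e ((φ γ).right i) := ⟨(φ γ).right⁻¹ (e.symm j), by simp⟩
    have h3 := h2 γ i
    have h4 : e ((φ γ).right i) = (ψ γ).right (e i) := h1 γ i
    rw [eq_mul_inv_iff_mul_eq] at h3
    simp only [WreathSymm.mul_left_apply]
    have h5 : (ψ γ).right⁻¹ (e ((φ γ).right i)) = e i := by rw [h4]; simp
    simpa [h5, ← h4] using h3
  · rintro ⟨k, hk⟩
    have hk' : ∀ γ, ψ γ * k = k * φ γ := fun γ => by rw [hk]; group
    have h1 : ∀ γ i, k.right ((φ γ).right i) = (ψ γ).right (k.right i) := fun γ i =>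
      (DFunLike.congr_fun (congrArg SemidirectProduct.right (hk' γ)) i).symm
    refine ⟨k.right, fun i => k.left (k.right i), h1, fun γ i => ?_⟩
    have h2 := congrFun (congrArg SemidirectProduct.left (hk' γ)) ((ψ γ).right (k.right i))
    have h3 : (ψ γ).right⁻¹ ((ψ γ).right (k.right i)) = k.right i := by simp
    simp only [WreathSymm.mul_left_apply, h3] at h2
    rw [eq_mul_inv_iff_mul_eq]
    simpa [← h1] using h2

/-- Every twisted action on a set of `n` elements comes from a homomorphism to the wreath
product. -/
theorem exists_iso_ofHom {n : ℕ} (F : TwistedAction Γ G X) (e : X ≃ Fin n) :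
    ∃ φ : Γ →* WreathSymm G n, F.Iso (ofHom φ) := by
  let φ : Γ →* WreathSymm G n := MonoidHom.mk'
    (fun γ => ⟨fun i => F.coc γ (F.perm γ⁻¹ (e.symm i)), e.permCongr (F.perm γ)⟩) (by
      intro γ δ
      ext i
      · have h : (e.permCongr (F.perm γ)).symm i = e ((F.perm γ).symm (e.symm i)) := rfl
        simp [WreathSymm.mul_left_apply, F.coc_mul, Equiv.Perm.inv_def, h]
      · simp [SemidirectProduct.mul_right])
  refine ⟨φ, e, fun _ => 1, fun γ x => ?_, fun γ x => ?_⟩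
  · simp [φ]
  · simp [φ]

theorem inv_smul_out_mul_mem {K : Subgroup Γ} (γ : Γ) (y : Γ ⧸ K) :
    (γ • y).out⁻¹ * (γ * y.out) ∈ K :=
  QuotientGroup.eq.1 (by
    rw [QuotientGroup.out_eq', ← smul_eq_mul, ← MulAction.Quotient.smul_mk,
      QuotientGroup.out_eq'])

/-- The action on the disjoint union of the `Γ ⧸ K j` with the cocycle induced, through coset
representatives, by homomorphisms `σ j : K j → G`. -/
noncomputable def induced (K : J → Subgroup Γ) (σ : ∀ j, K j →* G) :
    TwistedAction Γ G (Σ j, Γ ⧸ K j) where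
  perm := MulAction.toPermHom Γ _
  coc γ x := σ x.1 ⟨(γ • x.2).out⁻¹ * (γ * x.2.out), inv_smul_out_mul_mem γ x.2⟩
  coc_mul γ δ x := by
    obtain ⟨j, y⟩ := x
    refine (congrArg (σ j) (Subtype.ext ?_)).trans (map_mul (σ j) _ _)
    change ((γ * δ) • y).out⁻¹ * (γ * δ * y.out) =
      (γ • δ • y).out⁻¹ * (γ * (δ • y).out) * ((δ • y).out⁻¹ * (δ * y.out))
    rw [mul_smul]
    group

theorem induced_perm_apply (K : J → Subgroup Γ) (σ : ∀ j, K j →* G) (γ : Γ) (j : J)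
    (y : Γ ⧸ K j) : (induced K σ).perm γ ⟨j, y⟩ = ⟨j, γ • y⟩ := rfl

/-- The cocycle of the induced action, read off from any element of `K j` linking the chosen
representatives. -/
theorem induced_coc_apply (K : J → Subgroup Γ) (σ : ∀ j, K j →* G) (γ : Γ) (j : J)
    (y : Γ ⧸ K j) (η : K j) (hη : γ * y.out = (γ • y).out * η) :
    (induced K σ).coc γ ⟨j, y⟩ = σ j η :=
  congrArg (σ j) (Subtype.ext (inv_mul_eq_iff_eq_mul.2 hη))

theorem smul_out_eq {K : Subgroup Γ} (γ : Γ) (y : Γ ⧸ K) :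
    ∃ η : K, γ * y.out = (γ • y).out * η := by
  exact ⟨⟨_, inv_smul_out_mul_mem γ y⟩, by simp⟩

/-- A twisted action is isomorphic to the induced one of any family of base points, one in each
orbit, with their stabilizers `K j` and with homomorphisms `σ j` conjugate to the restrictions of
the cocycle. -/
theorem induced_iso (F : TwistedAction Γ G X) (K : J → Subgroup Γ) (σ : ∀ j, K j →* G)
    (b : J → X) (g : J → G) (hb : ∀ j γ, F.perm γ (b j) = b j ↔ γ ∈ K j)
    (hg : ∀ j (γ : K j), F.coc γ (b j) = g j * σ j γ * (g j)⁻¹)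
    (hex : ∀ x, ∃ j γ, F.perm γ (b j) = x)
    (huniq : ∀ j j' γ, F.perm γ (b j) = b j' → j = j') : (induced K σ).Iso F := by
  have hmk : ∀ j (γ : Γ), F.perm (γ : Γ ⧸ K j).out (b j) = F.perm γ (b j) := by
    intro j γ
    have h : γ⁻¹ * (γ : Γ ⧸ K j).out ∈ K j := QuotientGroup.eq.1 (QuotientGroup.out_eq' _).symm
    rw [← hb, map_mul, Equiv.Perm.mul_apply, map_inv, Equiv.Perm.inv_eq_iff_eq] at h
    exact h
  have hinj : ∀ j (y y' : Γ ⧸ K j), F.perm y.out (b j) = F.perm y'.out (b j) → y = y' := by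
    intro j y y' h
    rw [← QuotientGroup.out_eq' y, ← QuotientGroup.out_eq' y', QuotientGroup.eq, ← hb, map_mul,
      Equiv.Perm.mul_apply, map_inv, Equiv.Perm.inv_eq_iff_eq]
    exact h.symm
  have hbij : Function.Bijective fun x : Σ j, Γ ⧸ K j => F.perm x.2.out (b x.1) := by
    constructor
    · rintro ⟨j, y⟩ ⟨j', y'⟩ h
      have hj : j = j' := by
        refine huniq j j' (y'.out⁻¹ * y.out) ?_
        rw [map_mul, Equiv.Perm.mul_apply, map_inv, Equiv.Perm.inv_eq_iff_eq]
        exact h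
      subst hj
      rw [hinj j y y' h]
    · intro x
      obtain ⟨j, γ, rfl⟩ := hex x
      exact ⟨⟨j, γ⟩, hmk j γ⟩
  -- the fibre coordinate `g j` at the base point, carried along by the chosen representative of `y`
  refine ⟨Equiv.ofBijective _ hbij, fun x => F.coc x.2.out (b x.1) * g x.1, ?_, ?_⟩
  · rintro γ ⟨j, y⟩
    obtain ⟨η, hη⟩ := smul_out_eq γ y
    change F.perm (γ • y).out (b j) = F.perm γ (F.perm y.out (b j))
    rw [← Equiv.Perm.mul_apply, ← map_mul, hη, map_mul, Equiv.Perm.mul_apply, (hb j η).2 η.2]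
  · rintro γ ⟨j, y⟩
    obtain ⟨η, hη⟩ := smul_out_eq γ y
    rw [induced_coc_apply K σ γ j y η hη, eq_mul_inv_iff_mul_eq]
    change F.coc γ (F.perm y.out (b j)) * (F.coc y.out (b j) * g j) =
      F.coc (γ • y).out (b j) * g j * σ j η
    rw [← mul_assoc, ← F.coc_mul, hη, F.coc_mul, (hb j η).2 η.2, hg]
    group

end General
end TwistedAction

/-! ### Classification of twisted actions of a commutative group -/

/-- `(H t, ρ t)`, for `t : T`, represents exactly once each pair of a finite-index subgroup of `Γ`
and a conjugacy class of homomorphisms from it to `G`. For commutative `Γ` these are the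
isomorphism types of transitive twisted actions on finite sets. -/
structure IsTransversal {Γ G T : Type*} [Group Γ] [Group G] (H : T → Subgroup Γ)
    (ρ : ∀ t, H t →* G) : Prop where
  finiteIndex : ∀ t, (H t).FiniteIndex
  exists_conj : ∀ (K : Subgroup Γ) [K.FiniteIndex] (σ : K →* G), ∃ t g, H t = K ∧
    ∀ (γ : H t) (h : (γ : Γ) ∈ K), σ ⟨γ, h⟩ = g * ρ t γ * g⁻¹
  eq_of_conj : ∀ t t' g, H t = H t' →
    (∀ (γ : H t) (h : (γ : Γ) ∈ H t'), ρ t γ = g * ρ t' ⟨γ, h⟩ * g⁻¹) → t = t'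

namespace TwistedAction

section

variable {Γ G T X Y : Type*} [Group Γ] [Group G] {H : T → Subgroup Γ} {ρ : ∀ t, H t →* G}

/-- The point `x` has type `t`: its stabilizer is `H t`, and the cocycle restricts there to a
conjugate of `ρ t`. -/
def HasType (F : TwistedAction Γ G X) (ρ : ∀ t, H t →* G) (t : T) (x : X) : Prop :=
  (∀ γ, F.perm γ x = x ↔ γ ∈ H t) ∧ ∃ g, ∀ γ : H t, F.coc γ x = g * ρ t γ * g⁻¹

theorem HasType.unique (hT : IsTransversal H ρ) {F : TwistedAction Γ G X} {t t' : T} {x : X}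
    (h : F.HasType ρ t x) (h' : F.HasType ρ t' x) : t = t' := by
  obtain ⟨h1, g, h2⟩ := h
  obtain ⟨h1', g', h2'⟩ := h'
  refine hT.eq_of_conj t t' (g⁻¹ * g') (Subgroup.ext fun γ => (h1 γ).symm.trans (h1' γ)) ?_
  intro γ hγ
  have h3 := (h2 γ).symm.trans (h2' ⟨γ, hγ⟩)
  rw [mul_inv_eq_iff_eq_mul, ← eq_inv_mul_iff_mul_eq] at h3
  rw [h3]
  group

theorem exists_hasType [Finite X] (hT : IsTransversal H ρ) (F : TwistedAction Γ G X) (x : X) :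
    ∃ t, F.HasType ρ t x := by
  let K : Subgroup Γ := (MulAction.stabilizer (Equiv.Perm X) x).comap F.perm
  have hK : ∀ γ, F.perm γ x = x ↔ γ ∈ K := fun γ => Iff.rfl
  let σ : K →* G := MonoidHom.mk' (fun γ => F.coc γ x) fun γ δ => by
    rw [Subgroup.coe_mul, F.coc_mul, (hK δ).2 δ.2]
  have hfin : K.FiniteIndex := ⟨by
    rw [Subgroup.index_comap]
    exact ((MulAction.stabilizer (Equiv.Perm X) x).subgroupOf F.perm.range).index_ne_zero_of_finite⟩
  obtain ⟨t, g, h1, h2⟩ := hT.exists_conj K σ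
  exact ⟨t, fun γ => by rw [hK, h1], g, fun γ => h2 γ (h1 ▸ γ.2)⟩

theorem Iso.card_hasType_eq {F : TwistedAction Γ G X} {F' : TwistedAction Γ G Y} (i : F.Iso F')
    (ρ : ∀ t, H t →* G) (t : T) :
    Nat.card {x // F.HasType ρ t x} = Nat.card {y // F'.HasType ρ t y} := by
  obtain ⟨e, h, h1, h2⟩ := i
  refine Nat.card_congr (e.subtypeEquiv fun x => ?_)
  have h3 : ∀ γ, F'.perm γ (e x) = e x ↔ F.perm γ x = x := fun γ => by
    rw [← h1, e.apply_eq_iff_eq]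
  simp only [HasType, h3]
  refine and_congr_right fun hx => ?_
  have h4 : ∀ γ : H t, F'.coc γ (e x) = h x * F.coc γ x * (h x)⁻¹ := fun γ => by
    rw [h2, (hx γ).2 γ.2]
  constructor
  · rintro ⟨g, hg⟩
    refine ⟨h x * g, fun γ => ?_⟩
    rw [h4, hg]
    group
  · rintro ⟨g, hg⟩
    refine ⟨(h x)⁻¹ * g, fun γ => ?_⟩
    have h5 := (h4 γ).symm.trans (hg γ)
    rw [mul_inv_eq_iff_eq_mul, ← eq_inv_mul_iff_mul_eq] at h5
    rw [h5]
    group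

end

section Comm

variable {Γ G T X J : Type*} [CommGroup Γ] [Group G] {H : T → Subgroup Γ} {ρ : ∀ t, H t →* G}

theorem hasType_induced (ty : J → T) (j : J) (y : Γ ⧸ H (ty j)) :
    (induced (fun j => H (ty j)) fun j => ρ (ty j)).HasType ρ (ty j) ⟨j, y⟩ := by
  have hy : ∀ γ, γ • y = y ↔ γ ∈ H (ty j) := by
    intro γ
    obtain ⟨a, rfl⟩ := QuotientGroup.mk_surjective y
    rw [MulAction.Quotient.smul_mk, QuotientGroup.eq, smul_eq_mul, mul_comm γ a, mul_inv_rev,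
      inv_mul_cancel_right, inv_mem_iff]
  refine ⟨fun γ => ?_, 1, fun γ => ?_⟩
  · rw [induced_perm_apply, Sigma.mk.injEq, ← hy]
    simp
  · rw [induced_coc_apply (fun j => H (ty j)) (fun j => ρ (ty j)) γ j y γ
      (by rw [(hy γ).2 γ.2, mul_comm])]
    simp

/-- The finite set of pairs `(t, k)` with `k < f t`, indexing the elements of the multiset with
multiplicity function `f`. -/
abbrev MultisetIndex (f : T →₀ ℕ) : Type _ := Σ t : f.support, Fin (f t.1)

/-- The twisted action which is the disjoint union of `f t` copies of the transitive one of
type `t`. -/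
noncomputable def ofMultiset (ρ : ∀ t, H t →* G) (f : T →₀ ℕ) :
    TwistedAction Γ G (Σ j : MultisetIndex f, Γ ⧸ H j.1.1) :=
  induced (J := MultisetIndex f) (fun j => H j.1.1) fun j => ρ j.1.1

theorem finite_ofMultiset (hT : IsTransversal H ρ) (f : T →₀ ℕ) :
    Finite (Σ j : MultisetIndex f, Γ ⧸ H j.1.1) := by
  have := hT.finiteIndex
  infer_instance

theorem card_ofMultiset (hT : IsTransversal H ρ) (f : T →₀ ℕ) :
    Nat.card (Σ j : MultisetIndex f, Γ ⧸ H j.1.1) =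
      f.sum fun t k => k * (H t).index := by
  have := hT.finiteIndex
  rw [Nat.card_sigma, Fintype.sum_sigma]
  simp only [← Subgroup.index_eq_card, Finset.sum_const, Finset.card_univ, Fintype.card_fin,
    smul_eq_mul]
  exact Finset.sum_coe_sort f.support fun t => f t * (H t).index

theorem card_hasType_ofMultiset (hT : IsTransversal H ρ) (f : T →₀ ℕ) (t : T) :
    Nat.card {x // (ofMultiset ρ f).HasType ρ t x} = f t * (H t).index := by
  classical
  have hfin := hT.finiteIndex
  have : ∀ s, Fintype (Γ ⧸ H s) := fun s => Fintype.ofFinite _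
  have h1 : ∀ x, (ofMultiset ρ f).HasType ρ t x ↔ x.1.1.1 = t := fun x =>
    ⟨fun h => HasType.unique hT (hasType_induced (fun j : MultisetIndex f => j.1.1) x.1 x.2) h,
      fun h => h ▸ hasType_induced (fun j : MultisetIndex f => j.1.1) x.1 x.2⟩
  simp only [h1]
  rw [Nat.card_eq_fintype_card, Fintype.card_subtype, Finset.card_filter, Fintype.sum_sigma,
    Fintype.sum_sigma]
  have h2 : ∀ s : T, Fintype.card (Γ ⧸ H s) = (H s).index := fun s => by
    rw [Subgroup.index_eq_card, Nat.card_eq_fintype_card]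
  trans ∑ s : f.support, f s.1 * ((H s.1).index * if s.1 = t then 1 else 0)
  · refine Finset.sum_congr rfl fun s _ => ?_
    by_cases hs : s.1 = t <;> simp [hs, h2]
  · rw [Finset.sum_coe_sort f.support fun s => f s * ((H s).index * if s = t then 1 else 0)]
    simp +contextual

/-- Decomposition into orbits: every twisted action on a finite set is a disjoint union of
transitive ones. -/
theorem exists_ofMultiset_iso [Finite X] (hT : IsTransversal H ρ) (F : TwistedAction Γ G X) :
    ∃ f : T →₀ ℕ, (ofMultiset ρ f).Iso F := by
  classical
  let S : Setoid X :=
    { r := fun x y => ∃ γ, F.perm γ x = y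
      iseqv :=
        { refl := fun x => ⟨1, by simp⟩
          symm := by
            rintro x y ⟨γ, rfl⟩
            exact ⟨γ⁻¹, by simp⟩
          trans := by
            rintro x y z ⟨γ, rfl⟩ ⟨δ, rfl⟩
            exact ⟨δ * γ, by simp⟩ } }
  have := Fintype.ofFinite (Quotient S)
  choose typ htyp using fun ω : Quotient S => exists_hasType hT F ω.out
  let f : T →₀ ℕ := Finsupp.onFinset (Finset.univ.image typ)
    (fun t => Nat.card {ω // typ ω = t}) fun t ht => by
      obtain ⟨ω, hω⟩ := (Nat.card_ne_zero.1 ht).1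
      exact Finset.mem_image.2 ⟨ω, Finset.mem_univ _, hω⟩
  have hmem : ∀ ω, typ ω ∈ f.support := fun ω => by
    have : Nonempty {ω' // typ ω' = typ ω} := ⟨⟨ω, rfl⟩⟩
    exact Finsupp.mem_support_iff.2 Nat.card_pos.ne'
  obtain ⟨E, hE⟩ : ∃ E : MultisetIndex f ≃ Quotient S, ∀ j, typ (E j) = j.1 := by
    have e : ∀ t : f.support, Fin (f t) ≃ {ω // (⟨typ ω, hmem ω⟩ : f.support) = t} := fun t =>
      ((Equiv.subtypeEquivRight fun ω => Subtype.ext_iff).trans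
        (Finite.equivFinOfCardEq (rfl : Nat.card {ω // typ ω = t} = f t))).symm
    exact ⟨(Equiv.sigmaCongrRight e).trans (Equiv.sigmaFiberEquiv _),
      fun j => congrArg Subtype.val (e j.1 j.2).2⟩
  have hb : ∀ j, F.HasType ρ (j.1 : T) (E j).out := fun j => hE j ▸ htyp (E j)
  choose hb1 g hg using hb
  refine ⟨f, induced_iso F _ _ (fun j => (E j).out) g hb1 hg (fun x => ?_) fun j j' γ h => ?_⟩
  · obtain ⟨γ, hγ⟩ : S.r (E (E.symm ⟦x⟧)).out x := by
      rw [E.apply_symm_apply]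
      exact Quotient.exact (Quotient.out_eq _)
    exact ⟨_, γ, hγ⟩
  · refine E.injective ?_
    rw [← Quotient.out_eq (E j), ← Quotient.out_eq (E j')]
    exact Quotient.sound ⟨γ, h⟩

/-- Conjugacy classes of homomorphisms to `G ≀ S_n` correspond to multisets of transitive types
with `n` points altogether. -/
theorem card_homModConj_wreathSymm (hT : IsTransversal H ρ) (n : ℕ) :
    Nat.card (HomModConj Γ (WreathSymm G n)) = weightedCount (fun t => (H t).index) n := by
  have hex : ∀ f : {f : T →₀ ℕ // (f.sum fun t k => k * (H t).index) = n},
      ∃ φ : Γ →* WreathSymm G n, (ofMultiset ρ f.1).Iso (ofHom φ) := fun f =>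
    have := finite_ofMultiset hT f.1
    exists_iso_ofHom _ (Finite.equivFinOfCardEq ((card_ofMultiset hT f.1).trans f.2))
  choose Φ hΦ using hex
  -- injectivity: the number of points of each type recovers the multiset
  refine (Nat.card_congr (Equiv.ofBijective (fun f => (⟦Φ f⟧ : HomModConj Γ (WreathSymm G n)))
    ⟨fun f f' h => ?_, fun c => ?_⟩)).symm
  · have h1 := (ofHom_iso_ofHom_iff _ _).2 (Quotient.exact h)
    have h2 := (hΦ f).trans (h1.trans (hΦ f').symm)
    refine Subtype.ext (Finsupp.ext fun t => ?_)
    have h3 := h2.card_hasType_eq ρ t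
    rw [card_hasType_ofMultiset hT, card_hasType_ofMultiset hT] at h3
    exact Nat.eq_of_mul_eq_mul_right (Nat.pos_of_ne_zero (hT.finiteIndex t).index_ne_zero) h3
  · induction c using Quotient.inductionOn with | _ φ => ?_
    obtain ⟨f, hf⟩ := exists_ofMultiset_iso hT (ofHom φ)
    have := finite_ofMultiset hT f
    have hn : (f.sum fun t k => k * (H t).index) = n := by
      obtain ⟨e, -⟩ := hf
      rw [← card_ofMultiset hT, Nat.card_congr e, Nat.card_fin]
    exact ⟨⟨f, hn⟩, Quotient.sound
      ((ofHom_iso_ofHom_iff _ _).1 ((hΦ ⟨f, hn⟩).symm.trans hf))⟩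

end Comm
end TwistedAction

/-! ### Homomorphisms from `ℤ_p ^ d` to finite groups -/

section PadicHom

variable {p : ℕ} [Fact p.Prime] {d : ℕ}

/-- A finite quotient of `ℤ_p ^ d` is a `p`-group, because the prime-to-`p` part of its order acts
invertibly. -/
theorem exists_prime_pow_eq_one (p : ℕ) [Fact p.Prime] (H : Type*) [Group H] [Finite H] :
    ∃ a : ℕ, ∀ (d : ℕ) (φ : PadicPow p d →* H) (γ : PadicPow p d), φ γ ^ p ^ a = 1 := by
  have hp : p.Prime := Fact.out
  obtain ⟨a, m, hm, hN⟩ := Nat.exists_eq_pow_mul_and_not_dvd (n := Nat.card H)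
    Nat.card_pos.ne' p hp.ne_one
  refine ⟨a, fun d φ γ => ?_⟩
  have hu : IsUnit (m : ℤ_[p]) := by
    rw [PadicInt.isUnit_iff, PadicInt.norm_natCast_eq_one_iff]
    exact (Nat.Prime.coprime_iff_not_dvd hp).2 hm
  obtain ⟨u, hu⟩ := hu
  obtain ⟨δ, rfl⟩ : ∃ δ : PadicPow p d, γ = δ ^ m := by
    refine ⟨Multiplicative.ofAdd (((u⁻¹ : ℤ_[p]ˣ) : ℤ_[p]) • Multiplicative.toAdd γ), ?_⟩
    apply Multiplicative.toAdd.injective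
    rw [toAdd_pow, toAdd_ofAdd, ← Nat.cast_smul_eq_nsmul ℤ_[p], ← hu, smul_smul, Units.mul_inv,
      one_smul]
  rw [← map_pow, ← pow_mul, map_pow, mul_comm, ← hN, pow_card_eq_one']

theorem PadicInt.exists_eq_natCast_add_pow_mul (z : ℤ_[p]) (a : ℕ) :
    ∃ (c : ℕ) (u : ℤ_[p]), z = c + p ^ a * u := by
  obtain ⟨u, hu⟩ := Ideal.mem_span_singleton'.1 (PadicInt.appr_spec a z)
  exact ⟨z.appr a, u, by rw [mul_comm, hu]; ring⟩

/-- The `i`-th standard generator of `ℤ_p ^ d`. -/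
noncomputable def padicGen (p : ℕ) [Fact p.Prime] {d : ℕ} (i : Fin d) : PadicPow p d :=
  Multiplicative.ofAdd (Pi.single i 1)

/-- A homomorphism from `ℤ_p ^ d` to a finite group is determined by the images of the
generators, although these generate only a dense subgroup. -/
theorem padicHom_ext {H : Type*} [Group H] [Finite H] {φ ψ : PadicPow p d →* H}
    (h : ∀ i, φ (padicGen p i) = ψ (padicGen p i)) : φ = ψ := by
  obtain ⟨a, ha⟩ := exists_prime_pow_eq_one p H
  let E : AddSubgroup (Fin d → ℤ_[p]) := Subgroup.toAddSubgroup' (φ.eqLocus ψ)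
  have hE : ∀ v, v ∈ E ↔ φ (Multiplicative.ofAdd v) = ψ (Multiplicative.ofAdd v) :=
    fun v => Iff.rfl
  ext γ
  refine (hE (Multiplicative.toAdd γ)).1 ?_
  generalize Multiplicative.toAdd γ = v
  choose c u hcu using fun i => PadicInt.exists_eq_natCast_add_pow_mul (v i) a
  have hv : v = ∑ i, c i • Pi.single i (1 : ℤ_[p]) + p ^ a • u := by
    ext j
    simp [Finset.sum_apply, Pi.single_apply, hcu j]
  rw [hv]
  refine E.add_mem (E.sum_mem fun i _ => E.nsmul_mem ((hE _).2 (h i)) _) ((hE _).2 ?_)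
  rw [ofAdd_nsmul, map_pow, map_pow, ha, ha]

theorem exists_orderOf_padicHom {H : Type*} [Group H] [Finite H] (φ : PadicPow p d →* H)
    (γ : PadicPow p d) : ∃ k, orderOf (φ γ) = p ^ k := by
  obtain ⟨a, ha⟩ := exists_prime_pow_eq_one p H
  obtain ⟨k, -, hk⟩ := (Nat.dvd_prime_pow Fact.out).1 (orderOf_dvd_of_pow_eq_one (ha d φ γ))
  exact ⟨k, hk⟩

/-- For `x` of order `p ^ k`, the homomorphism `ℤ_p → H` taking `1` to `x`; it factors through
`ℤ / p ^ k`. -/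
theorem exists_padicHom_one {H : Type*} [Group H] (x : H) {k : ℕ} (hk : orderOf x = p ^ k) :
    ∃ f : Multiplicative ℤ_[p] →* H, f (Multiplicative.ofAdd 1) = x ∧
      ∀ z, f z ∈ Subgroup.zpowers x := by
  let g : ZMod (p ^ k) →+ Additive H := ZMod.lift (p ^ k)
    ⟨zmultiplesHom (Additive H) (Additive.ofMul x), by
      rw [zmultiplesHom_apply, natCast_zsmul, ← ofMul_pow, ← hk, pow_orderOf_eq_one, ofMul_one]⟩
  have hg : ∀ n : ℤ, g (n : ZMod (p ^ k)) = Additive.ofMul (x ^ n) := fun n => by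
    rw [ZMod.lift_coe]
    rfl
  refine ⟨AddMonoidHom.toMultiplicativeLeft
    (g.comp (PadicInt.toZModPow (p := p) k).toAddMonoidHom), ?_, fun z => ?_⟩
  · change (g (PadicInt.toZModPow k 1)).toMul = x
    rw [map_one, ← Int.cast_one, hg, toMul_ofMul, zpow_one]
  · obtain ⟨n, hn⟩ := ZMod.intCast_surjective (PadicInt.toZModPow k (Multiplicative.toAdd z))
    refine ⟨n, ?_⟩
    change x ^ n = (g (PadicInt.toZModPow k (Multiplicative.toAdd z))).toMul
    rw [← hn, hg, toMul_ofMul]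

theorem exists_padicHom {H : Type*} [Group H] (x : CommTuple p d H) :
    ∃ φ : PadicPow p d →* H, ∀ i, φ (padicGen p i) = x.1 i := by
  have hcomm := x.2.1
  choose k hk using x.2.2
  choose f hf1 hf using fun i => exists_padicHom_one (x.1 i) (hk i)
  have hc : Pairwise fun i j => ∀ a b, Commute (f i a) (f j b) := by
    intro i j _ a b
    obtain ⟨m, hm⟩ := hf i a
    obtain ⟨n, hn⟩ := hf j b
    rw [← hm, ← hn]
    exact (hcomm i j).zpow_zpow m n
  refine ⟨(MonoidHom.noncommPiCoprod f hc).comp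
    (MulEquiv.piMultiplicative fun _ : Fin d => ℤ_[p]).toMonoidHom, fun i => ?_⟩
  have h : MulEquiv.piMultiplicative (fun _ : Fin d => ℤ_[p]) (padicGen p i) =
      Pi.mulSingle i (Multiplicative.ofAdd 1) := by
    ext j
    by_cases hj : j = i
    · subst hj
      simp [padicGen]
    · simp [padicGen, hj]
  change MonoidHom.noncommPiCoprod f hc (MulEquiv.piMultiplicative _ (padicGen p i)) = x.1 i
  rw [h, MonoidHom.noncommPiCoprod_mulSingle, hf1]

/-- Homomorphisms from `ℤ_p ^ d` to a finite group correspond to commuting `d`-tuples of elements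
of `p`-power order: evaluate at the generators. -/
noncomputable def padicHomEquiv (p : ℕ) [Fact p.Prime] (d : ℕ) (H : Type*) [Group H] [Finite H] :
    (PadicPow p d →* H) ≃ CommTuple p d H :=
  Equiv.ofBijective
    (fun φ => ⟨fun i => φ (padicGen p i),
      fun i j => (Commute.all (padicGen p i) (padicGen p j)).map φ,
      fun _ => exists_orderOf_padicHom φ _⟩)
    ⟨fun _ _ h => padicHom_ext fun i => congrFun (congrArg Subtype.val h) i,
      fun x => (exists_padicHom x).imp fun _ h => Subtype.ext (funext h)⟩

theorem finite_homModConj_padicPow (p : ℕ) [Fact p.Prime] (d : ℕ) (H : Type*) [Group H]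
    [Finite H] : Finite (HomModConj (PadicPow p d) H) :=
  have := Finite.of_equiv _ (padicHomEquiv p d H).symm
  Quotient.finite _

theorem card_homModConj_eq_card_commTupleModConj (p : ℕ) [Fact p.Prime] (d : ℕ) (H : Type*)
    [Group H] [Finite H] :
    Nat.card (HomModConj (PadicPow p d) H) = Nat.card (CommTupleModConj p d H) := by
  refine Nat.card_congr (Quotient.congr (padicHomEquiv p d H) fun φ ψ => ?_)
  refine exists_congr fun h => ⟨fun h1 i => h1 _, fun h1 => ?_⟩
  exact DFunLike.congr_fun (padicHom_ext (ψ := (MulAut.conj h).toMonoidHom.comp φ) h1)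

end PadicHom

/-! ### Finite-index submodules of `ℤ_p ^ d` -/

/-- The `ℤ_p`-submodules of finite index of `M`. -/
abbrev FiniteIndexSubmodule (p : ℕ) [Fact p.Prime] (M : Type*) [AddCommGroup M]
    [Module ℤ_[p] M] : Type _ :=
  {N : Submodule ℤ_[p] M // N.toAddSubgroup.FiniteIndex}

section Submodules

variable {p : ℕ} [Fact p.Prime]

theorem index_span_prime_pow (p : ℕ) [Fact p.Prime] (l : ℕ) :
    (Submodule.toAddSubgroup (Ideal.span {(p : ℤ_[p]) ^ l})).index = p ^ l := by
  have h : Submodule.toAddSubgroup (Ideal.span {(p : ℤ_[p]) ^ l}) =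
      (PadicInt.toZModPow (p := p) l).toAddMonoidHom.ker := by
    rw [← PadicInt.ker_toZModPow]
    rfl
  rw [h, AddSubgroup.index_ker, AddMonoidHom.range_eq_top.2 (ZMod.ringHom_surjective _),
    AddSubgroup.card_top, Nat.card_zmod]

variable {M : Type*} [AddCommGroup M] [Module ℤ_[p] M]

/-- The submodule of `ℤ_p × M` that projects onto `p ^ l ℤ_p`, meets `M` in `N`, and contains
`(p ^ l, x)` for the elements `x` of the coset `q`. Every submodule of finite index has this
form. -/
noncomputable def glueSubmodule (l : ℕ) (N : Submodule ℤ_[p] M) (q : M ⧸ N) :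
    Submodule ℤ_[p] (ℤ_[p] × M) :=
  (Submodule.span ℤ_[p] {((p : ℤ_[p]) ^ l, q)}).comap (LinearMap.prodMap LinearMap.id N.mkQ)

theorem mem_glueSubmodule {l : ℕ} {N : Submodule ℤ_[p] M} {q : M ⧸ N} {r : ℤ_[p]} {x : M} :
    (r, x) ∈ glueSubmodule l N q ↔ ∃ a : ℤ_[p], a * p ^ l = r ∧ a • q = N.mkQ x := by
  rw [glueSubmodule, Submodule.mem_comap, Submodule.mem_span_singleton]
  simp

theorem prime_pow_ne_zero (p : ℕ) [Fact p.Prime] (l : ℕ) : (p : ℤ_[p]) ^ l ≠ 0 :=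
  pow_ne_zero _ (Nat.cast_ne_zero.2 (Fact.out : p.Prime).ne_zero)

theorem zero_mem_glueSubmodule {l : ℕ} {N : Submodule ℤ_[p] M} {q : M ⧸ N} {x : M} :
    ((0 : ℤ_[p]), x) ∈ glueSubmodule l N q ↔ x ∈ N := by
  rw [mem_glueSubmodule, ← Submodule.Quotient.mk_eq_zero N]
  constructor
  · rintro ⟨a, h1, h2⟩
    rw [(mul_eq_zero.1 h1).resolve_right (prime_pow_ne_zero p l), zero_smul] at h2
    exact h2.symm
  · intro h
    exact ⟨0, zero_mul _, by rw [zero_smul]; exact h.symm⟩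

theorem prime_pow_mem_glueSubmodule {l : ℕ} {N : Submodule ℤ_[p] M} {q : M ⧸ N} {x : M} :
    ((p : ℤ_[p]) ^ l, x) ∈ glueSubmodule l N q ↔ q = N.mkQ x := by
  rw [mem_glueSubmodule]
  constructor
  · rintro ⟨a, h1, h2⟩
    rwa [mul_eq_right₀ (prime_pow_ne_zero p l) |>.1 h1, one_smul] at h2
  · intro h
    exact ⟨1, one_mul _, by rw [one_smul, h]⟩

theorem index_glueSubmodule (l : ℕ) (N : Submodule ℤ_[p] M) (q : M ⧸ N) :
    (glueSubmodule l N q).toAddSubgroup.index = N.toAddSubgroup.index * p ^ l := by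
  set A := (glueSubmodule l N q).toAddSubgroup
  set B := (AddMonoidHom.inr ℤ_[p] M).range
  have h1 : B ⊔ A = (Submodule.toAddSubgroup (Ideal.span {(p : ℤ_[p]) ^ l})).comap
      (AddMonoidHom.fst ℤ_[p] M) := by
    apply le_antisymm
    · refine sup_le ?_ ?_
      · rintro _ ⟨x, rfl⟩
        exact zero_mem (Ideal.span {(p : ℤ_[p]) ^ l})
      · rintro ⟨r, x⟩ h
        obtain ⟨a, ha, -⟩ := mem_glueSubmodule.1 h
        exact Ideal.mem_span_singleton'.2 ⟨a, ha⟩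
    · rintro ⟨r, x⟩ h
      obtain ⟨a, ha⟩ := Ideal.mem_span_singleton'.1 h
      obtain ⟨y, hy⟩ := N.mkQ_surjective (a • q)
      have h2 : (r, x) = AddMonoidHom.inr ℤ_[p] M (x - y) + (r, y) := by
        ext <;> simp
      rw [h2]
      exact AddSubgroup.add_mem_sup ⟨_, rfl⟩ (mem_glueSubmodule.2 ⟨a, ha, hy.symm⟩)
  have h3 : A.comap (AddMonoidHom.inr ℤ_[p] M) = N.toAddSubgroup :=
    AddSubgroup.ext fun x => zero_mem_glueSubmodule
  rw [← AddSubgroup.relIndex_mul_index (le_sup_right : A ≤ B ⊔ A), AddSubgroup.relIndex_sup_right,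
    ← AddSubgroup.index_comap, h3, h1, AddSubgroup.index_comap_of_surjective _ Prod.fst_surjective,
    index_span_prime_pow]

theorem exists_eq_glueSubmodule (N : FiniteIndexSubmodule p (ℤ_[p] × M)) :
    ∃ (l : ℕ) (N' : FiniteIndexSubmodule p M) (q : M ⧸ N'.1), glueSubmodule l N'.1 q = N.1 := by
  obtain ⟨N, hN⟩ := N
  have hJ : N.map (LinearMap.fst ℤ_[p] ℤ_[p] M) ≠ ⊥ := by
    intro h
    have h1 : N.toAddSubgroup.index • ((1 : ℤ_[p]), (0 : M)) ∈ N :=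
      N.toAddSubgroup.nsmul_index_mem _
    have h2 := Submodule.mem_map_of_mem (f := LinearMap.fst ℤ_[p] ℤ_[p] M) h1
    rw [h, Submodule.mem_bot] at h2
    simp [hN.index_ne_zero] at h2
  obtain ⟨l, hl⟩ := PadicInt.ideal_eq_span_pow_p hJ
  have hmem : (p : ℤ_[p]) ^ l ∈ N.map (LinearMap.fst ℤ_[p] ℤ_[p] M) := by
    rw [hl]
    exact Ideal.mem_span_singleton_self _
  obtain ⟨⟨r, y⟩, hy, hr⟩ := hmem
  obtain rfl : r = (p : ℤ_[p]) ^ l := hr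
  have hN' : (N.comap (LinearMap.inr ℤ_[p] ℤ_[p] M)).toAddSubgroup.FiniteIndex := ⟨by
    have h := AddSubgroup.index_comap N.toAddSubgroup (AddMonoidHom.inr ℤ_[p] M)
    refine h.trans_ne ?_
    exact (AddSubgroup.instFiniteIndex_addSubgroupOf N.toAddSubgroup _).index_ne_zero⟩
  refine ⟨l, ⟨_, hN'⟩, Submodule.Quotient.mk y, ?_⟩
  ext ⟨r, x⟩
  have hsub : ∀ a : ℤ_[p], (a * p ^ l, x) - a • ((p : ℤ_[p]) ^ l, y) = (0, x - a • y) := by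
    intro a
    simp
  rw [mem_glueSubmodule]
  have hq : ∀ a : ℤ_[p], a • (Submodule.Quotient.mk y :
      M ⧸ N.comap (LinearMap.inr ℤ_[p] ℤ_[p] M)) = Submodule.mkQ _ x ↔ (a * p ^ l, x) ∈ N := by
    intro a
    rw [← Submodule.Quotient.mk_smul, Submodule.mkQ_apply, eq_comm, Submodule.Quotient.eq,
      Submodule.mem_comap, LinearMap.inr_apply, ← hsub, N.sub_mem_iff_left (N.smul_mem a hy)]
  simp only [hq]
  constructor
  · rintro ⟨a, rfl, h⟩
    exact h
  · intro h
    have h1 := Submodule.mem_map_of_mem (f := LinearMap.fst ℤ_[p] ℤ_[p] M) h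
    rw [hl] at h1
    obtain ⟨a, ha⟩ := Ideal.mem_span_singleton'.1 h1
    have ha' : a * (p : ℤ_[p]) ^ l = r := ha
    exact ⟨a, ha', ha'.symm ▸ h⟩

/-- A submodule of finite index of `ℤ_p × M` amounts to an exponent, a submodule of finite index of
`M`, and a coset of the latter. -/
noncomputable def glueEquiv (p : ℕ) [Fact p.Prime] (M : Type*) [AddCommGroup M]
    [Module ℤ_[p] M] :
    (Σ x : ℕ × FiniteIndexSubmodule p M, M ⧸ x.2.1) ≃ FiniteIndexSubmodule p (ℤ_[p] × M) :=
  Equiv.ofBijective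
    (fun x => ⟨glueSubmodule x.1.1 x.1.2.1 x.2, ⟨by
      rw [index_glueSubmodule]
      exact mul_ne_zero x.1.2.2.index_ne_zero (pow_ne_zero _ (Fact.out : p.Prime).ne_zero)⟩⟩) <| by
    constructor
    · have hle : ∀ {l l' : ℕ} {N N' : Submodule ℤ_[p] M} {q : M ⧸ N} {q' : M ⧸ N'},
          glueSubmodule l N q = glueSubmodule l' N' q' → l' ≤ l := by
        intro l l' N N' q q' h
        obtain ⟨x, hx⟩ := N.mkQ_surjective q
        have h1 := (prime_pow_mem_glueSubmodule (l := l)).2 hx.symm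
        rw [h, mem_glueSubmodule] at h1
        obtain ⟨a, ha, -⟩ := h1
        exact (pow_dvd_pow_iff (Nat.cast_ne_zero.2 (Fact.out : p.Prime).ne_zero)
          PadicInt.prime_p.not_isUnit).1 ⟨a, by rw [← ha, mul_comm]⟩
      rintro ⟨⟨l, N, hN⟩, q⟩ ⟨⟨l', N', hN'⟩, q'⟩ h
      have h1 : glueSubmodule l N q = glueSubmodule l' N' q' := congrArg Subtype.val h
      obtain rfl : l = l' := le_antisymm (hle h1.symm) (hle h1)
      obtain rfl : N = N' := Submodule.ext fun x => by
        rw [← zero_mem_glueSubmodule (l := l) (q := q), h1, zero_mem_glueSubmodule]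
      obtain ⟨x, hx⟩ := N.mkQ_surjective q
      have h2 := (prime_pow_mem_glueSubmodule (l := l)).2 hx.symm
      rw [h1, prime_pow_mem_glueSubmodule, hx] at h2
      rw [h2]
    · intro N
      obtain ⟨l, N', q, h⟩ := exists_eq_glueSubmodule N
      exact ⟨⟨⟨l, N'⟩, q⟩, Subtype.ext h⟩

theorem index_comap_linearEquiv {M' : Type*} [AddCommGroup M'] [Module ℤ_[p] M']
    (e : M ≃ₗ[ℤ_[p]] M') (N : Submodule ℤ_[p] M') :
    (N.comap e.toLinearMap).toAddSubgroup.index = N.toAddSubgroup.index :=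
  AddSubgroup.index_comap_of_surjective N.toAddSubgroup (f := e.toLinearMap.toAddMonoidHom)
    e.surjective

/-- Transport of submodules of finite index along a linear equivalence. -/
noncomputable def finiteIndexSubmoduleCongr {M' : Type*} [AddCommGroup M'] [Module ℤ_[p] M']
    (e : M ≃ₗ[ℤ_[p]] M') : FiniteIndexSubmodule p M' ≃ FiniteIndexSubmodule p M where
  toFun N := ⟨N.1.comap e.toLinearMap,
    ⟨by rw [index_comap_linearEquiv]; exact N.2.index_ne_zero⟩⟩
  invFun N := ⟨N.1.comap e.symm.toLinearMap,
    ⟨by rw [index_comap_linearEquiv]; exact N.2.index_ne_zero⟩⟩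
  left_inv N := Subtype.ext (Submodule.ext fun x => by simp)
  right_inv N := Subtype.ext (Submodule.ext fun x => by simp)

/-- Count of submodules of finite index: they are labelled by `ℓ : Fin d → ℕ` (the diagonal of the
Hermite normal form is `p ^ ℓ`) so that the index is `p ^ ∑ ℓ i` and each label is attained
`p ^ ∑ i * ℓ i` times. -/
theorem exists_label_finiteIndexSubmodule (p : ℕ) [Fact p.Prime] (d : ℕ) :
    ∃ L : FiniteIndexSubmodule p (Fin d → ℤ_[p]) → (Fin d → ℕ),
      (∀ N, N.1.toAddSubgroup.index = p ^ ∑ i, L N i) ∧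
      ∀ ℓ, Nat.card {N // L N = ℓ} = p ^ ∑ i : Fin d, (i : ℕ) * ℓ i := by
  induction d with
  | zero =>
    refine ⟨fun _ => Fin.elim0, fun N => ?_, fun ℓ => ?_⟩
    · rw [Subsingleton.elim N.1.toAddSubgroup ⊤]
      simp
    · have : Unique {N : FiniteIndexSubmodule p (Fin 0 → ℤ_[p]) // Fin.elim0 = ℓ} :=
        { default := ⟨⟨⊤, ⟨by
            rw [Submodule.top_toAddSubgroup, AddSubgroup.index_top]
            exact one_ne_zero⟩⟩, Subsingleton.elim _ _⟩
          uniq := fun N => Subtype.ext (Subtype.ext (Subsingleton.elim _ _)) }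
      rw [Nat.card_unique]
      simp
  | succ d ih =>
    obtain ⟨L, hL1, hL2⟩ := ih
    let e := (finiteIndexSubmoduleCongr
      (Fin.consLinearEquiv ℤ_[p] fun _ : Fin (d + 1) => ℤ_[p])).trans
      (glueEquiv p (Fin d → ℤ_[p])).symm
    refine ⟨fun N => Fin.cons (e N).1.1 (L (e N).1.2), fun N => ?_, fun ℓ => ?_⟩
    · obtain ⟨⟨⟨l, N'⟩, q⟩, rfl⟩ := e.symm.surjective N
      have h : (e.symm ⟨(l, N'), q⟩).1.toAddSubgroup.index = N'.1.toAddSubgroup.index * p ^ l := by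
        rw [← index_glueSubmodule l N'.1 q, ← index_comap_linearEquiv
          (Fin.consLinearEquiv ℤ_[p] fun _ : Fin (d + 1) => ℤ_[p]).symm]
        rfl
      beta_reduce
      rw [h, hL1, e.apply_symm_apply, Fin.sum_univ_succ, ← pow_add]
      simp [add_comm]
    · have e1 : {N // (Fin.cons (e N).1.1 (L (e N).1.2) : Fin (d + 1) → ℕ) = ℓ} ≃
          Σ N' : {N' // L N' = Fin.tail ℓ}, (Fin d → ℤ_[p]) ⧸ N'.1.1 :=
        { toFun := fun N => ⟨⟨(e N.1).1.2, congrArg Fin.tail N.2⟩, (e N.1).2⟩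
          invFun := fun x => ⟨e.symm ⟨(ℓ 0, x.1.1), x.2⟩, by
            rw [e.apply_symm_apply, x.1.2, Fin.cons_self_tail]⟩
          left_inv := by
            rintro ⟨N, rfl⟩
            exact Subtype.ext (e.symm_apply_apply N)
          right_inv := by
            rintro ⟨⟨N', hN'⟩, q⟩
            have h : ∀ y : (Σ x : ℕ × FiniteIndexSubmodule p (Fin d → ℤ_[p]),
                (Fin d → ℤ_[p]) ⧸ x.2.1), y = ⟨(ℓ 0, N'), q⟩ → ∀ hy : L y.1.2 = Fin.tail ℓ,
                (⟨⟨y.1.2, hy⟩, y.2⟩ : Σ N' : {N' // L N' = Fin.tail ℓ},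
                  (Fin d → ℤ_[p]) ⧸ N'.1.1) = ⟨⟨N', hN'⟩, q⟩ := by
              rintro _ rfl _
              rfl
            exact h _ (e.apply_symm_apply _) _ }
      have hfin : Finite {N' // L N' = Fin.tail ℓ} := Nat.finite_of_card_ne_zero (by
        rw [hL2]
        exact pow_ne_zero _ (Fact.out : p.Prime).ne_zero)
      have := Fintype.ofFinite {N' // L N' = Fin.tail ℓ}
      have hfin' : ∀ N' : {N' // L N' = Fin.tail ℓ}, Finite ((Fin d → ℤ_[p]) ⧸ N'.1.1) :=
        fun N' => have := N'.1.2; inferInstanceAs (Finite (_ ⧸ N'.1.1.toAddSubgroup))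
      have hcard : ∀ N' : {N' // L N' = Fin.tail ℓ},
          Nat.card ((Fin d → ℤ_[p]) ⧸ N'.1.1) = p ^ ∑ i, Fin.tail ℓ i := fun N' => by
        have h := hL1 N'.1
        rw [N'.2] at h
        exact h
      rw [Nat.card_congr e1, Nat.card_sigma, Finset.sum_congr rfl fun N' _ => hcard N',
        Finset.sum_const, Finset.card_univ, ← Nat.card_eq_fintype_card, hL2, smul_eq_mul, ← pow_add,
        ← Finset.sum_add_distrib, Fin.sum_univ_succ]
      simp [Fin.tail, add_mul]

end Submodules

/-! ### Finite-index subgroups of `ℤ_p ^ d` and their homomorphisms -/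

section Transversal

variable {p : ℕ} [Fact p.Prime] {d : ℕ}

theorem finrank_finiteIndexSubmodule (N : FiniteIndexSubmodule p (Fin d → ℤ_[p])) :
    Module.finrank ℤ_[p] N.1 = d := by
  obtain ⟨N, hN⟩ := N
  apply le_antisymm
  · simpa using Submodule.finrank_le N
  · -- multiplication by the index embeds the whole module in `N`
    let f : (Fin d → ℤ_[p]) →ₗ[ℤ_[p]] N :=
      LinearMap.codRestrict N (LinearMap.lsmul ℤ_[p] _ (N.toAddSubgroup.index : ℤ_[p])) fun v => by
        rw [LinearMap.lsmul_apply, Nat.cast_smul_eq_nsmul]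
        exact N.toAddSubgroup.nsmul_index_mem v
    have hf : Function.Injective f := by
      intro v w h
      have h1 : (N.toAddSubgroup.index : ℤ_[p]) • v = (N.toAddSubgroup.index : ℤ_[p]) • w :=
        congrArg Subtype.val h
      exact smul_right_injective _ (Nat.cast_ne_zero.2 hN.index_ne_zero) h1
    simpa using LinearMap.finrank_le_finrank_of_injective hf

/-- The finite-index submodule `N` as a subgroup of the multiplicatively written `ℤ_p ^ d`. -/
noncomputable abbrev FiniteIndexSubmodule.toSubgroup (N : FiniteIndexSubmodule p (Fin d → ℤ_[p])) :
    Subgroup (PadicPow p d) :=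
  AddSubgroup.toSubgroup N.1.toAddSubgroup

theorem index_toSubgroup (N : FiniteIndexSubmodule p (Fin d → ℤ_[p])) :
    N.toSubgroup.index = N.1.toAddSubgroup.index := rfl

/-- A subgroup of finite index of `ℤ_p ^ d` is itself isomorphic to `ℤ_p ^ d`. -/
theorem nonempty_toSubgroup_mulEquiv (N : FiniteIndexSubmodule p (Fin d → ℤ_[p])) :
    Nonempty (N.toSubgroup ≃* PadicPow p d) := by
  have e : N.1 ≃ₗ[ℤ_[p]] (Fin d → ℤ_[p]) :=
    LinearEquiv.ofFinrankEq _ _ (by rw [finrank_finiteIndexSubmodule, Module.finrank_fin_fun])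
  exact ⟨{ toFun := fun x => Multiplicative.ofAdd (e ⟨Multiplicative.toAdd x.1, x.2⟩)
           invFun := fun v => ⟨Multiplicative.ofAdd (e.symm (Multiplicative.toAdd v)).1,
             (e.symm (Multiplicative.toAdd v)).2⟩
           left_inv := fun x => by simp
           right_inv := fun v => by simp
           map_mul' := fun x y => e.map_add ⟨Multiplicative.toAdd x.1, x.2⟩
            ⟨Multiplicative.toAdd y.1, y.2⟩ }⟩

/-- Subgroups of finite index of `ℤ_p ^ d` are `ℤ_p`-submodules: they contain `p ^ a ℤ_p ^ d` for
some `a`, and modulo that scalars act through integers. -/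
theorem exists_toSubgroup_eq (K : Subgroup (PadicPow p d)) [K.FiniteIndex] :
    ∃ N : FiniteIndexSubmodule p (Fin d → ℤ_[p]), N.toSubgroup = K := by
  obtain ⟨a, ha⟩ := exists_prime_pow_eq_one p (PadicPow p d ⧸ K)
  let A : AddSubgroup (Fin d → ℤ_[p]) := Subgroup.toAddSubgroup' K
  have hA : ∀ u, p ^ a • u ∈ A := fun u => by
    have h := ha d (QuotientGroup.mk' K) (Multiplicative.ofAdd u)
    rw [← map_pow, QuotientGroup.mk'_apply, QuotientGroup.eq_one_iff] at h
    exact h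
  let N : Submodule ℤ_[p] (Fin d → ℤ_[p]) :=
    { A with
      smul_mem' := fun z v hv => by
        obtain ⟨c, u, rfl⟩ := PadicInt.exists_eq_natCast_add_pow_mul z a
        rw [add_smul, mul_smul, Nat.cast_smul_eq_nsmul, ← Nat.cast_pow, Nat.cast_smul_eq_nsmul]
        exact A.add_mem (A.nsmul_mem hv c) (hA (u • v)) }
  exact ⟨⟨N, ⟨Subgroup.FiniteIndex.index_ne_zero (H := K)⟩⟩, rfl⟩

variable {G : Type*} [Group G]

/-- The homomorphisms from subgroups of finite index of `ℤ_p ^ d` to `G`, up to conjugacy: choose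
the subgroup, and a class of homomorphisms `ℤ_p ^ d → G` to be transported along a fixed
isomorphism. -/
noncomputable def padicTransversal
    (t : FiniteIndexSubmodule p (Fin d → ℤ_[p]) × HomModConj (PadicPow p d) G) :
    t.1.toSubgroup →* G :=
  t.2.out.comp (nonempty_toSubgroup_mulEquiv t.1).some.toMonoidHom

theorem isTransversal_padicTransversal (p : ℕ) [Fact p.Prime] (d : ℕ) (G : Type*) [Group G] :
    IsTransversal (fun t : FiniteIndexSubmodule p (Fin d → ℤ_[p]) ×
      HomModConj (PadicPow p d) G => t.1.toSubgroup) padicTransversal where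
  finiteIndex t := ⟨t.1.2.index_ne_zero⟩
  exists_conj K hK σ := by
    obtain ⟨N, rfl⟩ := exists_toSubgroup_eq K
    set e := (nonempty_toSubgroup_mulEquiv N).some with he
    obtain ⟨g, hg⟩ := Quotient.exact (Quotient.out_eq
      (⟦σ.comp e.symm.toMonoidHom⟧ : HomModConj (PadicPow p d) G))
    refine ⟨(N, ⟦σ.comp e.symm.toMonoidHom⟧), g, rfl, fun γ h => ?_⟩
    have h1 := hg (e γ)
    rw [MonoidHom.comp_apply, MulEquiv.toMonoidHom_eq_coe, MonoidHom.coe_coe,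
      MulEquiv.symm_apply_apply] at h1
    exact h1
  eq_of_conj := by
    rintro ⟨⟨N, hN⟩, c⟩ ⟨⟨N', hN'⟩, c'⟩ g h hconj
    obtain rfl : N = N' := Submodule.ext fun v => by
      have h1 := SetLike.ext_iff.1 h (Multiplicative.ofAdd v)
      exact h1
    refine Prod.ext rfl ?_
    rw [← Quotient.out_eq c, ← Quotient.out_eq c']
    suffices hc : (homConjSetoid (PadicPow p d) G).r c'.out c.out from (Quotient.sound hc).symm
    refine ⟨g, fun k => ?_⟩
    let e := (nonempty_toSubgroup_mulEquiv ⟨N, hN⟩).some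
    obtain ⟨γ, rfl⟩ := e.surjective k
    exact hconj γ γ.2

end Transversal

/-! ### The generating function -/

/-- The infinite product converges unconditionally in `ℤ⟦q⟧` (coefficientwise topology) to a unit
`P`; it ranges over all `ℓ = (ℓ_1, …, ℓ_d)`, with `ℓ_(i+1)` written `ℓ i` for `i : Fin d`. -/
theorem mainTheorem5 (p : ℕ) [Fact p.Prime] (d : ℕ) (G : Type*) [Group G] [Finite G] :
    Finite (HomModConj (PadicPow p d) G) ∧
    (∀ n : ℕ, Finite (HomModConj (PadicPow p d) (WreathSymm G n)) ∧
      Nat.card (HomModConj (PadicPow p d) (WreathSymm G n)) =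
        Nat.card (CommTupleModConj p d (WreathSymm G n))) ∧
    ∃ P : ℤ⟦X⟧ˣ,
      HasProd
        (fun ℓ : Fin d → ℕ =>
          (1 - (PowerSeries.X : ℤ⟦X⟧) ^ p ^ (∑ i, ℓ i)) ^ p ^ (∑ i : Fin d, (i : ℕ) * ℓ i))
        (P : ℤ⟦X⟧) ∧
      PowerSeries.mk
          (fun n => (Nat.card (HomModConj (PadicPow p d) (WreathSymm G n)) : ℤ)) =
        ((P ^ (-(Nat.card (HomModConj (PadicPow p d) G) : ℤ)) : ℤ⟦X⟧ˣ) : ℤ⟦X⟧) := by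
  have hG := finite_homModConj_padicPow p d G
  have hW : ∀ n, Finite (WreathSymm G n) := fun n =>
    Finite.of_equiv _ SemidirectProduct.equivProd.symm
  refine ⟨hG, fun n => ⟨finite_homModConj_padicPow p d _,
    card_homModConj_eq_card_commTupleModConj p d _⟩, ?_⟩
  have hp : 1 < p := (Fact.out : p.Prime).one_lt
  obtain ⟨L, hL1, hL2⟩ := exists_label_finiteIndexSubmodule p d
  have hfin : ∀ n, {ℓ : Fin d → ℕ | p ^ (∑ i, ℓ i) ≤ n}.Finite := fun n =>
    (Set.finite_Iic fun _ : Fin d => n).subset fun ℓ hℓ i =>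
      ((Finset.single_le_sum (fun _ _ => Nat.zero_le _) (Finset.mem_univ i)).trans
        (Nat.lt_pow_self hp).le).trans hℓ
  obtain ⟨P, hP1, hP2⟩ := exists_unit_hasProd_weightedCount_prod
    (C := HomModConj (PadicPow p d) G) L (fun ℓ => p ^ ∑ i, ℓ i)
    (fun ℓ => p ^ ∑ i : Fin d, (i : ℕ) * ℓ i) (fun _ => by positivity) hfin
    (fun _ => by positivity) hL2
  refine ⟨P, hP1, ?_⟩
  rw [← hP2]
  congr 1
  funext n
  rw [TwistedAction.card_homModConj_wreathSymm (isTransversal_padicTransversal p d G)]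
  simp only [index_toSubgroup, hL1]
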